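/- Let $G$ be an H-type group with underlying manifold $\mathbb R^{2n}\times\mathbb R^m$, where $m>1$ is the dimension of its centre: the Lie algebra is $\mathfrak g=\mathfrak v\oplus\mathfrak z$ (orthogonal sum) with $\mathfrak v=\mathbb R^{2n}$, with centre $\mathfrak z=\mathbb R^m$ and $[\mathfrak v,\mathfrak v]=\mathfrak z$; for every $t\in\mathfrak z$ with $|t|=1$ the map $J_t$ on $\mathfrak v$ given by $\langle J_tu,w\rangle=\langle t,[u,w]\rangle$ is orthogonal; and the group law is $(z,t)(z',t')=(z+z',\,t+t'+\tfrac12[z,z'])$. Let $L$ be the sublaplacian, $T=-\sum_{k}\partial_{t_k}^2$, and $\Delta=L+T$ the full Laplacian. For $a\in\mathbb R^m$ and $k\ge 0$ put $$e^a_k(z,t)=e^{-i\langle a,t\rangle}\,L_k^{n-1}\!\left(\tfrac12|a||z|^2\right)e^{-\frac14|a||z|^2},$$ where $L_k^{n-1}$ is the Laguerre polynomial of type $n-1$ and degree $k$. These are joint eigenfunctions of $L$ and $T$ with eigenvalues $(2k+n)|a|$ and $|a|^2$, and the joint functional calculus of $L$ and $T$ is given, for bounded $h$ on $\mathbb R_+\times\mathbb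 R_+$ and Schwartz functions $f$, by $$h(L,T)f=\int_0^\infty\frac1{(2\pi)^{n+m}}\sum_{k=0}^\infty h\big((2k+n)\lambda,\lambda^2\big)\,\lambda^{n+m-1}\int_{S^{m-1}}f*e_k^{\lambda\omega}\,d\sigma(\omega)\,d\lambda ,$$ where $*$ is the convolution of $G$ and $\sigma$ is the surface measure. For $\mu>0$ the restriction operator of $\Delta$ is $$\mathcal P_\mu^\Delta f=\lim_{\varepsilon\to0^+}\frac1{2\varepsilon}\,\chi_{(\mu-\varepsilon,\mu+\varepsilon)}(\Delta)f\quad\text{(pointwise)},$$ where $\chi_{(\mu-\varepsilon,\mu+\varepsilon)}(\Delta)=h(L,T)$ with $h(\xi,\eta)=\chi_{(\mu-\varepsilon,\mu+\varepsilon)}(\xi+\eta)$. Let $\frac{2m+2}{m+3}<p\le\infty$, let $\frac1p+\frac1{p'}=1$, and let $\mu>0$ (for example $\mu=2n^2$). Then there is no constant $C<\infty$ such that $$\|\mathcal P_\mu^\Delta f\|_{L^{p'}(G)}\le C\,\|f\|_{L^p(G)}$$ for all Schwartz functions $f$ on $G$. -/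

import Mathlib

open MeasureTheory Set Filter Topology
open scoped ENNReal NNReal SchwartzMap

noncomputable section

/-- The orthogonal complement `𝔳 = 𝔷^⊥ = ℝ²ⁿ` of the centre, with its Euclidean inner product. -/
abbrev HLayer (n : ℕ) : Type := EuclideanSpace ℝ (Fin (2 * n))

/-- The centre `𝔷 = ℝᵐ`, with its Euclidean inner product. -/
abbrev HCentre (m : ℕ) : Type := EuclideanSpace ℝ (Fin m)

/-- An H-type Lie algebra structure on the orthogonal sum `𝔤 = 𝔳 ⊕ 𝔷 = ℝ²ⁿ ⊕ ℝᵐ`.  The Lie bracket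
is `[(u, s), (w, t)] = (0, bracket u w)`, so that `𝔤` is two step nilpotent. -/
structure HTypeAlgebra (n m : ℕ) where
  /-- the bracket `[u, w] ∈ 𝔷` of `u, w ∈ 𝔳` -/
  bracket : HLayer n →ₗ[ℝ] HLayer n →ₗ[ℝ] HCentre m
  bracket_self : ∀ u, bracket u u = 0
  /-- the centre of `𝔤` is not larger than `𝔷` -/
  centre_eq : ∀ u, (∀ w, bracket u w = 0) → u = 0
  /-- `[𝔷^⊥, 𝔷^⊥] = 𝔷` -/
  span_bracket : Submodule.span ℝ {t | ∃ u w, bracket u w = t} = ⊤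
  /-- the map `J_t` with `⟨J_t u, w⟩ = ⟨t, [u, w]⟩` is orthogonal whenever `|t| = 1` -/
  orthogonal_J : ∀ t : HCentre m, ‖t‖ = 1 →
    ∃ J : HLayer n ≃ₗᵢ[ℝ] HLayer n, ∀ u w, inner ℝ (J u) w = inner ℝ t (bracket u w)

namespace HTypeAlgebra

variable {n m : ℕ} (H : HTypeAlgebra n m)

/-- The law `(z, t)(z', t') = (z + z', t + t' + [z, z'] / 2)` of the H-type group, which is
identified with its Lie algebra through the exponential map. -/
def mul (x y : HLayer n × HCentre m) : HLayer n × HCentre m :=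
  (x.1 + y.1, x.2 + y.2 + (1 / 2 : ℝ) • H.bracket x.1 y.1)

/-- The inverse `(z, t)⁻¹ = (-z, -t)` in the H-type group. -/
def inv (x : HLayer n × HCentre m) : HLayer n × HCentre m := (-x.1, -x.2)

/-- `inv` is the inverse of the group law. -/
theorem mul_inv_self (x : HLayer n × HCentre m) :
    H.mul x (inv x) = 0 ∧ H.mul (inv x) x = 0 := by
  simp [mul, inv, H.bracket_self]

/-- The group law is associative. -/
theorem mul_assoc' (x y w : HLayer n × HCentre m) :
    H.mul (H.mul x y) w = H.mul x (H.mul y w) := by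
  simp only [mul, map_add, LinearMap.add_apply, smul_add, Prod.mk.injEq]
  exact ⟨add_assoc _ _ _, by abel⟩

/-- Convolution `(f * g)(x) = ∫ f(y) g(y⁻¹ x) dy` on the H-type group (Haar measure is Lebesgue
measure). -/
def conv (f g : HLayer n × HCentre m → ℂ) (x : HLayer n × HCentre m) : ℂ :=
  ∫ y, f y * g (H.mul (inv y) x)

end HTypeAlgebra

/-- The Laguerre polynomial `L_k^α` of type `α` and degree `k`. -/
def laguerrePoly (α k : ℕ) (x : ℝ) : ℝ :=
  ∑ i ∈ Finset.range (k + 1),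
    (-1) ^ i * ((k + α).choose (k - i) : ℝ) * x ^ i / (i.factorial : ℝ)

/-- The Laguerre function `φ_k^l(z) = L_k^{n-1}(l |z|² / 2) exp(-l |z|² / 4)` on `ℝ²ⁿ`. -/
def laguerreFun (n k : ℕ) (l : ℝ) (z : HLayer n) : ℝ :=
  laguerrePoly (n - 1) k (l * ‖z‖ ^ 2 / 2) * Real.exp (-(l * ‖z‖ ^ 2 / 4))

/-- `e_k^a(z, t) = exp(-i⟨a, t⟩) φ_k^{|a|}(z)`, the joint eigenfunction of the sublaplacian `L`
and of `T` (minus the Laplacian in the central variables), with the eigenvalues `(2k + n)|a|`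
and `|a|²`. -/
def jointEigenfun (n : ℕ) {m : ℕ} (k : ℕ) (a : HCentre m) (x : HLayer n × HCentre m) : ℂ :=
  Complex.exp (-(Complex.I * ((inner ℝ a x.2 : ℝ) : ℂ))) * ((laguerreFun n k ‖a‖ x.1 : ℝ) : ℂ)

namespace HTypeAlgebra

variable {n m : ℕ} (H : HTypeAlgebra n m)

/-- The joint functional calculus of `L` and `T`:
`h(L, T) f = ∫₀^∞ (2π)^{-(n+m)} ∑ₖ h((2k+n)l, l²) l^{n+m-1} ∫_{S^{m-1}} f * e_k^{lω} dσ(ω) dl`. -/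
def functionalCalculus (h : ℝ → ℝ → ℝ) (f : HLayer n × HCentre m → ℂ)
    (x : HLayer n × HCentre m) : ℂ :=
  ∫ l in Ioi (0 : ℝ), (((1 / (2 * Real.pi) ^ (n + m) : ℝ)) : ℂ) *
    ∑' k : ℕ, ((h ((2 * k + n) * l) (l ^ 2) * l ^ (n + m - 1) : ℝ) : ℂ) *
      ∫ ω : Metric.sphere (0 : HCentre m) 1,
        H.conv f (jointEigenfun n k (l • (ω : HCentre m))) x
          ∂((volume : Measure (HCentre m)).toSphere)

/-- The spectral projection `χ_{(μ-ε, μ+ε)}(Δ)` of the full Laplacian `Δ = L + T`. -/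
def laplacianWindow (μ ε : ℝ) (f : HLayer n × HCentre m → ℂ) :
    HLayer n × HCentre m → ℂ :=
  H.functionalCalculus (fun ξ η => (Ioo (μ - ε) (μ + ε)).indicator (fun _ => (1 : ℝ)) (ξ + η)) f

/-- `g = 𝒫_μ^Δ f`, where `𝒫_μ^Δ f = δ_μ(Δ) f = lim_{ε → 0+} (2ε)⁻¹ χ_{(μ-ε, μ+ε)}(Δ) f`. -/
def IsRestriction (μ : ℝ) (f g : HLayer n × HCentre m → ℂ) : Prop :=
  ∀ x, Tendsto (fun ε : ℝ => (1 / (2 * ε)) • H.laplacianWindow μ ε f x) (𝓝[>] 0) (𝓝 (g x))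

end HTypeAlgebra

end

/-!
The obstruction is Knapp's example for the Fourier restriction theorem on a sphere in the centre.

Let `l₀ > 0` solve `l₀² + n l₀ = μ`. It is the largest of the frequencies `l` with
`l² + (2k + n) l = μ`, `k ≥ 0`, that make up the spectral sphere `Δ = μ`, and the only one with
`k = 0`. If `f = u ⊗ v`, then `f * e_k^a` is the central character of `-a` times the Fourier
transform of `v` at `a` times a twisted convolution of `u` with a Laguerre function
(`HTypeAlgebra.conv_jointEigenfun`). So if the Fourier transform of `v` is concentrated near the
point `l₀ e`, `|e| = 1`, all terms with `k ≥ 1` vanish for narrow windows, and the restriction of `f`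
is a constant times an integral over the sphere of radius `l₀` in the centre
(`HTypeAlgebra.isRestriction_tensor`, `tendsto_window_average`).

Take for the Fourier transform of `v` a bump function adapted to a box at `l₀ e` of thickness `s²` in
the direction `e` and of width `s` in the orthogonal directions (`knappBump`). By the curvature of the
sphere the box contains a cap of measure of order `s ^ (m - 1)` (`exists_mul_pow_le_toSphere_cap`), and
on the dual box in `t`, of volume of order `s ^ (-(m + 1))`, there is no cancellation for small `z`,
because the twisted convolution of the bump function `u` with the Gaussian `φ_0` is positive at `z = 0`
(`HTypeAlgebra.exists_le_norm_groundSphereIntegral`). So `‖𝒫 f‖_q` is at least of order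
`s ^ (m - 1 - (m + 1) / q)`, whereas a change of variables shows that `‖f‖_p` is a constant times
`s ^ (m + 1) * s ^ (-(m + 1) / p) = s ^ ((m + 1) / q)`
(`eLpNorm_schwartzTensor_fourier_knappBump`). An inequality `‖𝒫 f‖_q ≤ C ‖f‖_p` for all `s → 0` would
force `2 (m + 1) / q ≤ m - 1`, which is the opposite of `p > (2m + 2) / (m + 3)`.
-/

open scoped FourierTransform RealInnerProductSpace Pointwise

noncomputable section

/-! ### Tensor products of Schwartz functions -/

/-- The tensor product `(x, y) ↦ u x * v y` of two Schwartz functions. -/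
def schwartzTensor {E F : Type*} [NormedAddCommGroup E] [NormedSpace ℝ E] [NormedAddCommGroup F]
    [NormedSpace ℝ F] (u : 𝓢(E, ℂ)) (v : 𝓢(F, ℂ)) : 𝓢(E × F, ℂ) where
  toFun x := u x.1 * v x.2
  smooth' := ((u.smooth ⊤).comp contDiff_fst).mul ((v.smooth ⊤).comp contDiff_snd)
  decay' k j := by
    choose A hA using u.decay'
    choose B hB using v.decay'
    have hu : ∀ i (x : E × F), ‖iteratedFDeriv ℝ i (fun y : E × F => u y.1) x‖
        ≤ ‖iteratedFDeriv ℝ i u x.1‖ := fun i x => by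
      have h := ContinuousLinearMap.iteratedFDeriv_comp_right (ContinuousLinearMap.fst ℝ E F)
        (u.smooth ⊤) x (i := i) (by exact_mod_cast le_top)
      change ‖iteratedFDeriv ℝ i (u ∘ ContinuousLinearMap.fst ℝ E F) x‖ ≤ _
      rw [h]
      refine (ContinuousMultilinearMap.norm_compContinuousLinearMap_le _ _).trans ?_
      refine mul_le_of_le_one_right (norm_nonneg _) (Finset.prod_le_one (fun _ _ => norm_nonneg _)
        fun _ _ => ContinuousLinearMap.norm_fst_le ℝ E F)
    have hv : ∀ i (x : E × F), ‖iteratedFDeriv ℝ i (fun y : E × F => v y.2) x‖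
        ≤ ‖iteratedFDeriv ℝ i v x.2‖ := fun i x => by
      have h := ContinuousLinearMap.iteratedFDeriv_comp_right (ContinuousLinearMap.snd ℝ E F)
        (v.smooth ⊤) x (i := i) (by exact_mod_cast le_top)
      change ‖iteratedFDeriv ℝ i (v ∘ ContinuousLinearMap.snd ℝ E F) x‖ ≤ _
      rw [h]
      refine (ContinuousMultilinearMap.norm_compContinuousLinearMap_le _ _).trans ?_
      refine mul_le_of_le_one_right (norm_nonneg _) (Finset.prod_le_one (fun _ _ => norm_nonneg _)
        fun _ _ => ContinuousLinearMap.norm_snd_le ℝ E F)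
    refine ⟨∑ i ∈ Finset.range (j + 1), (j.choose i : ℝ) *
      (A k i * B 0 (j - i) + A 0 i * B k (j - i)), fun x => ?_⟩
    have h1 := norm_iteratedFDeriv_mul_le (𝕜 := ℝ) ((u.smooth ⊤).comp contDiff_fst)
      ((v.smooth ⊤).comp contDiff_snd) x (n := j) (by exact_mod_cast le_top)
    refine (mul_le_mul_of_nonneg_left h1 (by positivity)).trans ?_
    rw [Finset.mul_sum]
    refine Finset.sum_le_sum fun i _ => ?_
    have hk : ‖x‖ ^ k ≤ ‖x.1‖ ^ k + ‖x.2‖ ^ k := by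
      rcases le_total ‖x.1‖ ‖x.2‖ with h | h
      · rw [Prod.norm_def, max_eq_right h]
        exact le_add_of_nonneg_left (by positivity)
      · rw [Prod.norm_def, max_eq_left h]
        exact le_add_of_nonneg_right (by positivity)
    have a1 : ‖x.1‖ ^ k * ‖iteratedFDeriv ℝ i u x.1‖ ≤ A k i := hA k i x.1
    have a0 : ‖x.1‖ ^ 0 * ‖iteratedFDeriv ℝ i u x.1‖ ≤ A 0 i := hA 0 i x.1
    have b1 : ‖x.2‖ ^ k * ‖iteratedFDeriv ℝ (j - i) v x.2‖ ≤ B k (j - i) := hB k (j - i) x.2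
    have b0 : ‖x.2‖ ^ 0 * ‖iteratedFDeriv ℝ (j - i) v x.2‖ ≤ B 0 (j - i) := hB 0 (j - i) x.2
    rw [pow_zero, one_mul] at a0 b0
    calc ‖x‖ ^ k * ((j.choose i : ℝ) * ‖iteratedFDeriv ℝ i (u ∘ Prod.fst) x‖ *
          ‖iteratedFDeriv ℝ (j - i) (v ∘ Prod.snd) x‖)
        ≤ (‖x.1‖ ^ k + ‖x.2‖ ^ k) * ((j.choose i : ℝ) * ‖iteratedFDeriv ℝ i u x.1‖ *
          ‖iteratedFDeriv ℝ (j - i) v x.2‖) := by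
          gcongr
          · exact hu i x
          · exact hv (j - i) x
      _ = (j.choose i : ℝ) * ((‖x.1‖ ^ k * ‖iteratedFDeriv ℝ i u x.1‖) *
            ‖iteratedFDeriv ℝ (j - i) v x.2‖ + ‖iteratedFDeriv ℝ i u x.1‖ *
            (‖x.2‖ ^ k * ‖iteratedFDeriv ℝ (j - i) v x.2‖)) := by ring
      _ ≤ _ := by
          gcongr
          · exact le_trans (by positivity) a1
          · exact le_trans (by positivity) a0

@[simp]
theorem schwartzTensor_apply {E F : Type*} [NormedAddCommGroup E] [NormedSpace ℝ E]
    [NormedAddCommGroup F] [NormedSpace ℝ F] (u : 𝓢(E, ℂ)) (v : 𝓢(F, ℂ)) (x : E × F) :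
    schwartzTensor u v x = u x.1 * v x.2 := rfl

/-! ### Anisotropic dilations and spherical caps -/

section Dilation

variable {m : ℕ} (i₀ : Fin m)

/-- The anisotropic dilation of `ℝᵐ` that multiplies the coordinate `i₀` by `a` and every other
coordinate by `b`. -/
def anisoDilation (a b : ℝ) : HCentre m →ₗ[ℝ] HCentre m :=
  Matrix.toEuclideanLin (Matrix.diagonal (fun i => if i = i₀ then a else b))

theorem anisoDilation_apply (a b : ℝ) (x : HCentre m) (i : Fin m) :
    anisoDilation i₀ a b x i = (if i = i₀ then a else b) * x i := by
  simp [anisoDilation, Matrix.toLpLin_apply, Matrix.mulVec_diagonal]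

theorem anisoDilation_anisoDilation (a b a' b' : ℝ) (x : HCentre m) :
    anisoDilation i₀ a b (anisoDilation i₀ a' b' x) = anisoDilation i₀ (a * a') (b * b') x := by
  ext i
  simp only [anisoDilation_apply]
  split_ifs <;> ring

theorem anisoDilation_one_one (x : HCentre m) : anisoDilation i₀ 1 1 x = x := by
  ext i
  simp [anisoDilation_apply]

theorem det_anisoDilation (a b : ℝ) : LinearMap.det (anisoDilation i₀ a b) = a * b ^ (m - 1) := by
  change LinearMap.det (Matrix.toLpLin 2 2 _) = _
  rw [Matrix.toLpLin_eq_toLin, LinearMap.det_toLin, Matrix.det_diagonal,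
    Finset.prod_ite, Finset.prod_const, Finset.prod_const, Finset.filter_eq',
    Finset.filter_ne']
  simp

theorem inner_anisoDilation (a b : ℝ) (x y : HCentre m) :
    ⟪anisoDilation i₀ a b x, y⟫ = ⟪x, anisoDilation i₀ a b y⟫ := by
  simp only [PiLp.inner_apply, anisoDilation_apply]
  refine Finset.sum_congr rfl fun i _ => ?_
  simp only [RCLike.inner_apply, conj_trivial]
  ring

theorem norm_anisoDilation_le {a b c : ℝ} (ha : |a| ≤ c) (hb : |b| ≤ c) (x : HCentre m) :
    ‖anisoDilation i₀ a b x‖ ≤ c * ‖x‖ := by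
  have hc : 0 ≤ c := (abs_nonneg a).trans ha
  rw [← Real.sqrt_sq hc, EuclideanSpace.norm_eq, EuclideanSpace.norm_eq,
    ← Real.sqrt_mul (sq_nonneg c), Finset.mul_sum]
  refine Real.sqrt_le_sqrt (Finset.sum_le_sum fun i _ => ?_)
  rw [anisoDilation_apply, norm_mul, mul_pow]
  gcongr
  split_ifs <;> simpa

theorem continuous_anisoDilation (a b : ℝ) : Continuous (anisoDilation i₀ a b) :=
  LinearMap.continuous_of_finiteDimensional _

theorem norm_sq_eq_add_anisoDilation (x : HCentre m) :
    ‖x‖ ^ 2 = x i₀ ^ 2 + ‖anisoDilation i₀ 0 1 x‖ ^ 2 := by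
  have h : ∀ i, x i ^ 2 = (if i = i₀ then x i₀ ^ 2 else 0) + anisoDilation i₀ 0 1 x i ^ 2 :=
    fun i => by
      rw [anisoDilation_apply]
      split_ifs with hi <;> simp [hi]
  rw [EuclideanSpace.real_norm_sq_eq, EuclideanSpace.real_norm_sq_eq, Finset.sum_congr rfl
    fun i _ => h i, Finset.sum_add_distrib]
  simp

/-- The points of the unit sphere within distance of order `s` of the `i₀`-th unit vector, and within
distance of order `s ^ 2` of its tangent plane, have spherical measure at least of order
`s ^ (m - 1)`: near that vector the sphere leaves its tangent plane only to second order, so the second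
condition costs nothing. -/
theorem exists_mul_pow_le_toSphere_cap {L : ℝ} (hL : 0 < L) :
    ∃ κ : ℝ≥0∞, κ ≠ 0 ∧ κ ≠ ∞ ∧ ∀ s : ℝ, 0 < s → s ≤ 1 → κ * ENNReal.ofReal (s ^ (m - 1)) ≤
      (volume : Measure (HCentre m)).toSphere {ω | ‖anisoDilation i₀ (s⁻¹ ^ 2) s⁻¹
        (L • ((ω : HCentre m) - EuclideanSpace.single i₀ 1))‖ ≤ 1} := by
  set e : HCentre m := EuclideanSpace.single i₀ 1 with he
  have he0 : e i₀ = 1 := by simp [he]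
  have hen : ‖e‖ = 1 := by simp [he]
  set r : ℝ := min (1 / 8) (1 / (6 * L)) with hr
  have hr0 : 0 < r := lt_min (by norm_num) (by positivity)
  have hr8 : r ≤ 1 / 8 := min_le_left _ _
  have hrL : 6 * L * r ≤ 1 := by
    have : r ≤ 1 / (6 * L) := min_le_right _ _
    rw [le_div_iff₀ (by positivity)] at this
    linarith
  have hm : m ≠ 0 := fun h => by subst h; exact i₀.elim0
  refine ⟨m * volume (Metric.ball ((1 / 2 : ℝ) • e) r), mul_ne_zero (by exact_mod_cast hm)
    (Metric.measure_ball_pos _ _ hr0).ne', ENNReal.mul_ne_top (by simp) measure_ball_lt_top.ne,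
    fun s hs hs1 => ?_⟩
  have hmeas : MeasurableSet {ω : Metric.sphere (0 : HCentre m) 1 |
      ‖anisoDilation i₀ (s⁻¹ ^ 2) s⁻¹ (L • ((ω : HCentre m) - e))‖ ≤ 1} := by
    refine (isClosed_le ?_ continuous_const).measurableSet
    exact ((continuous_anisoDilation i₀ _ _).comp (by fun_prop)).norm
  rw [Measure.toSphere_apply' _ hmeas, finrank_euclideanSpace, Fintype.card_fin, mul_assoc]
  gcongr
  -- The cone over the cap contains the image of a fixed ball under the dilation by `s` in the
  -- directions orthogonal to `e`.
  have hdet : volume (anisoDilation i₀ 1 s '' Metric.ball ((1 / 2 : ℝ) • e) r)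
      = volume (Metric.ball ((1 / 2 : ℝ) • e) r) * ENNReal.ofReal (s ^ (m - 1)) := by
    rw [Measure.addHaar_image_linearMap, det_anisoDilation, one_mul,
      abs_of_nonneg (by positivity), mul_comm]
  rw [← hdet]
  refine measure_mono ?_
  rintro _ ⟨y, hy, rfl⟩
  rw [mem_ball_iff_norm] at hy
  set x := anisoDilation i₀ 1 s y with hx
  have hx0 : x i₀ = y i₀ := by simp [hx, anisoDilation_apply]
  have hy0 : 1 / 4 ≤ y i₀ := by
    have h1 := (PiLp.norm_apply_le (y - (1 / 2 : ℝ) • e) i₀).trans hy.le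
    simp only [PiLp.sub_apply, PiLp.smul_apply, he0, smul_eq_mul, Real.norm_eq_abs] at h1
    have := (abs_le.1 h1).1
    linarith
  have hxn : 1 / 4 ≤ ‖x‖ := by
    have h1 := PiLp.norm_apply_le x i₀
    rw [hx0, Real.norm_eq_abs] at h1
    exact hy0.trans ((le_abs_self _).trans h1)
  have hx1 : ‖x‖ < 1 := by
    have h1 : ‖x‖ ≤ 1 * ‖y‖ := norm_anisoDilation_le i₀ (by simp) (by rwa [abs_of_pos hs]) y
    have h2 : ‖y‖ ≤ ‖y - (1 / 2 : ℝ) • e‖ + ‖(1 / 2 : ℝ) • e‖ := by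
      simpa using norm_add_le (y - (1 / 2 : ℝ) • e) ((1 / 2 : ℝ) • e)
    rw [norm_smul, hen] at h2
    norm_num at h2
    linarith
  have hxpos : 0 < ‖x‖ := by linarith
  set ω : HCentre m := ‖x‖⁻¹ • x with hω
  have hω1 : ‖ω‖ = 1 := by
    rw [hω, norm_smul, norm_inv, norm_norm, inv_mul_cancel₀ hxpos.ne']
  have hperp : ‖anisoDilation i₀ 0 1 ω‖ ≤ 4 * r * s := by
    have h1 : anisoDilation i₀ 0 1 ω
        = (‖x‖⁻¹ * s) • anisoDilation i₀ 0 1 (y - (1 / 2 : ℝ) • e) := by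
      ext i
      simp only [hω, hx, map_smul, PiLp.smul_apply, anisoDilation_apply, smul_eq_mul,
        PiLp.sub_apply]
      by_cases hi : i = i₀
      · simp [hi]
      · simp [hi, he]
        ring
    rw [h1, norm_smul, Real.norm_of_nonneg (by positivity)]
    have h2 : ‖anisoDilation i₀ 0 1 (y - (1 / 2 : ℝ) • e)‖ ≤ 1 * ‖y - (1 / 2 : ℝ) • e‖ :=
      norm_anisoDilation_le i₀ (by simp) (by simp) _
    have h3 : ‖x‖⁻¹ ≤ 4 := by
      rw [inv_le_comm₀ hxpos (by norm_num)]
      linarith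
    calc ‖x‖⁻¹ * s * ‖anisoDilation i₀ 0 1 (y - (1 / 2 : ℝ) • e)‖ ≤ 4 * s * r := by
          gcongr
          linarith
      _ = _ := by ring
  have hω0 : 0 ≤ ω i₀ := by
    simp only [hω, PiLp.smul_apply, smul_eq_mul, hx0]
    exact mul_nonneg (by positivity) (by linarith)
  have hω0' : |ω i₀ - 1| ≤ 16 * r ^ 2 * s ^ 2 := by
    have h1 := norm_sq_eq_add_anisoDilation i₀ ω
    rw [hω1] at h1
    have h2 : ‖anisoDilation i₀ 0 1 ω‖ ^ 2 ≤ (4 * r * s) ^ 2 :=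
      pow_le_pow_left₀ (norm_nonneg _) hperp 2
    have h3 : ω i₀ ≤ 1 := by nlinarith [sq_nonneg ‖anisoDilation i₀ 0 1 ω‖]
    rw [abs_sub_comm, abs_of_nonneg (by linarith)]
    nlinarith
  have hdec : anisoDilation i₀ (s⁻¹ ^ 2) s⁻¹ (ω - e)
      = (s⁻¹ ^ 2 * (ω i₀ - 1)) • e + s⁻¹ • anisoDilation i₀ 0 1 ω := by
    ext i
    simp only [anisoDilation_apply, PiLp.add_apply, PiLp.smul_apply, PiLp.sub_apply, smul_eq_mul]
    by_cases hi : i = i₀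
    · simp [hi, he0]
    · simp [hi, he]
  refine Set.mem_smul.2 ⟨‖x‖, ⟨hxpos, hx1⟩, ω, ⟨⟨ω, by simpa using hω1⟩, ?_, rfl⟩, ?_⟩
  · change ‖anisoDilation i₀ (s⁻¹ ^ 2) s⁻¹ (L • (ω - e))‖ ≤ 1
    rw [map_smul, norm_smul, Real.norm_of_nonneg hL.le, hdec]
    have h1 : ‖(s⁻¹ ^ 2 * (ω i₀ - 1)) • e + s⁻¹ • anisoDilation i₀ 0 1 ω‖
        ≤ s⁻¹ ^ 2 * (16 * r ^ 2 * s ^ 2) + s⁻¹ * (4 * r * s) := by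
      refine (norm_add_le _ _).trans ?_
      rw [norm_smul, norm_smul, hen, mul_one, norm_mul, Real.norm_of_nonneg (by positivity),
        Real.norm_of_nonneg (by positivity : 0 ≤ s⁻¹), Real.norm_eq_abs]
      gcongr
    have h2 : s⁻¹ ^ 2 * (16 * r ^ 2 * s ^ 2) + s⁻¹ * (4 * r * s) = 16 * r ^ 2 + 4 * r := by
      field_simp
    rw [h2] at h1
    calc L * _ ≤ L * (16 * r ^ 2 + 4 * r) := by gcongr
      _ ≤ L * (6 * r) := by gcongr; nlinarith
      _ ≤ 1 := by linarith
  · rw [hω, smul_smul, mul_inv_cancel₀ hxpos.ne', one_smul]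

end Dilation

/-! ### The density of a spectral window -/

/-- The averages over the windows `(μ - ε, μ + ε)` in the variable `ν l + l²` converge to the value
at the root `l₀` of `ν l + l² = μ`, divided by the derivative `ν + 2 l₀` of `ν l + l²` at `l₀`. -/
theorem tendsto_window_average {ν l₀ μ : ℝ} (hν : 0 ≤ ν) (hl : 0 < l₀) (hμ : l₀ ^ 2 + ν * l₀ = μ)
    {B : ℝ → ℂ} (hB : Continuous B) :
    Tendsto (fun ε : ℝ => (1 / (2 * ε)) • ∫ l in Ioi (0 : ℝ),
      (((Ioo (μ - ε) (μ + ε)).indicator (fun _ => (1 : ℝ)) (ν * l + l ^ 2) : ℝ) : ℂ) * B l)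
      (𝓝[>] 0) (𝓝 ((ν + 2 * l₀)⁻¹ • B l₀)) := by
  have hμ0 : 0 < μ := by rw [← hμ]; positivity
  -- `r` is the inverse of `l ↦ l² + ν l` on the positive half line.
  set r : ℝ → ℝ := fun y => (-ν + √(ν ^ 2 + 4 * y)) / 2 with hr
  have hsq : √(ν ^ 2 + 4 * μ) = ν + 2 * l₀ := by
    rw [Real.sqrt_eq_iff_mul_self_eq (by positivity) (by positivity), ← hμ]
    ring
  have hrμ : r μ = l₀ := by simp only [hr, hsq]; ring
  have hrd : HasDerivAt r (ν + 2 * l₀)⁻¹ μ := by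
    have h1 : HasDerivAt (fun y : ℝ => ν ^ 2 + 4 * y) 4 μ := by
      simpa using ((hasDerivAt_id μ).const_mul 4).const_add (ν ^ 2)
    have h2 := ((h1.sqrt (by positivity)).const_add (-ν)).div_const 2
    refine h2.congr_deriv ?_
    rw [hsq]
    field_simp
    norm_num
  have hr_nonneg : ∀ y, 0 ≤ y → 0 ≤ r y := fun y hy => by
    have : ν ≤ √(ν ^ 2 + 4 * y) := Real.le_sqrt_of_sq_le (by linarith)
    simp only [hr]
    linarith
  have hr_lt : ∀ y l, 0 < l → (r y < l ↔ y < ν * l + l ^ 2) := fun y l hl => by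
    have h1 : r y < l ↔ √(ν ^ 2 + 4 * y) < 2 * l + ν := by
      simp only [hr]
      constructor <;> intro h <;> linarith
    rw [h1, Real.sqrt_lt' (by positivity)]
    constructor <;> intro h <;> nlinarith
  have hlt_r : ∀ y l, 0 < l → (l < r y ↔ ν * l + l ^ 2 < y) := fun y l hl => by
    have h1 : l < r y ↔ 2 * l + ν < √(ν ^ 2 + 4 * y) := by
      simp only [hr]
      constructor <;> intro h <;> linarith
    rw [h1, Real.lt_sqrt (by positivity)]
    constructor <;> intro h <;> nlinarith
  set P : ℝ → ℂ := fun y => ∫ l in (0 : ℝ)..r y, B l with hP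
  have hPd : HasDerivAt P ((ν + 2 * l₀)⁻¹ • B l₀) μ := by
    have h1 : HasDerivAt (fun x => ∫ l in (0 : ℝ)..x, B l) (B (r μ)) (r μ) :=
      intervalIntegral.integral_hasDerivAt_right (hB.intervalIntegrable _ _)
        (hB.stronglyMeasurableAtFilter _ _) hB.continuousAt
    have h2 := h1.scomp μ hrd
    rwa [hrμ] at h2
  have hsym : HasDerivAt (fun ε => P (μ + ε) - P (μ - ε)) ((2 : ℝ) • ((ν + 2 * l₀)⁻¹ • B l₀)) 0 := by
    have h1 : HasDerivAt (fun ε : ℝ => P (μ + ε)) ((ν + 2 * l₀)⁻¹ • B l₀) 0 :=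
      HasDerivAt.comp_const_add μ 0 (by simpa using hPd)
    have h2 : HasDerivAt (fun ε : ℝ => P (μ - ε)) (-((ν + 2 * l₀)⁻¹ • B l₀)) 0 :=
      HasDerivAt.comp_const_sub μ 0 (by simpa using hPd)
    refine (h1.sub h2).congr_deriv ?_
    rw [two_smul, sub_neg_eq_add]
  have hlim := (hsym.tendsto_slope_zero_right).const_smul (1 / 2 : ℝ)
  rw [smul_smul, show (1 / 2 : ℝ) * 2 = 1 by norm_num, one_smul] at hlim
  refine hlim.congr' ?_
  have hε : ∀ᶠ ε : ℝ in 𝓝[>] 0, 0 < ε ∧ ε < μ := Ioo_mem_nhdsGT hμ0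
  filter_upwards [hε] with ε hε
  have hle : r (μ - ε) ≤ r (μ + ε) := by
    simp only [hr]
    gcongr
    linarith
  have h0 := hr_nonneg (μ - ε) (by linarith)
  have hint : ∫ l in Ioi (0 : ℝ),
      (((Ioo (μ - ε) (μ + ε)).indicator (fun _ => (1 : ℝ)) (ν * l + l ^ 2) : ℝ) : ℂ) * B l
      = P (μ + ε) - P (μ - ε) := by
    rw [hP, intervalIntegral.integral_interval_sub_left (hB.intervalIntegrable _ _)
      (hB.intervalIntegrable _ _), intervalIntegral.integral_of_le hle, integral_Ioc_eq_integral_Ioo,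
      ← integral_indicator measurableSet_Ioi, ← integral_indicator measurableSet_Ioo]
    congr 1
    ext l
    by_cases hl : 0 < l
    · rw [indicator_of_mem (mem_Ioi.2 hl)]
      by_cases hm : l ∈ Ioo (r (μ - ε)) (r (μ + ε))
      · rw [indicator_of_mem hm, indicator_of_mem
          (mem_Ioo.2 ⟨(hr_lt _ _ hl).1 hm.1, (hlt_r _ _ hl).1 hm.2⟩)]
        simp
      · rw [indicator_of_notMem hm, indicator_of_notMem fun h =>
          hm ⟨(hr_lt _ _ hl).2 h.1, (hlt_r _ _ hl).2 h.2⟩]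
        simp
    · rw [indicator_of_notMem (by simpa using hl), indicator_of_notMem fun h =>
        hl (h0.trans_lt h.1)]
  rw [hint]
  simp only [zero_add, add_zero, sub_zero, sub_self, smul_smul]
  congr 1
  field_simp

/-! ### The restriction operator on functions with separated variables -/

/-- The Fourier integral `∫ v(τ) exp(i⟨a, τ⟩) dτ` in the central variables. -/
def centralTransform {m : ℕ} (v : HCentre m → ℂ) (a : HCentre m) : ℂ :=
  ∫ τ, v τ * Complex.exp (Complex.I * ((⟪a, τ⟫ : ℝ) : ℂ))

theorem centralTransform_fourier {m : ℕ} (ψ : 𝓢(HCentre m, ℂ)) (a : HCentre m) :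
    centralTransform (𝓕 ψ : 𝓢(HCentre m, ℂ)) a = ψ ((2 * Real.pi)⁻¹ • a) := by
  have h0 : 𝓕⁻ (𝓕 ψ : 𝓢(HCentre m, ℂ)) = ψ := FourierTransform.fourierInv_fourier_eq ψ
  have h := congrArg (fun f : 𝓢(HCentre m, ℂ) => f ((2 * Real.pi)⁻¹ • a)) h0
  simp only [SchwartzMap.fourierInv_coe, Real.fourierInv_eq'] at h
  rw [← h, centralTransform]
  refine integral_congr_ae (Eventually.of_forall fun τ => ?_)
  simp only [smul_eq_mul]
  rw [mul_comm, inner_smul_right, real_inner_comm]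
  congr 2
  have : (Real.pi : ℂ) ≠ 0 := by exact_mod_cast Real.pi_ne_zero
  push_cast
  field_simp

theorem laguerreFun_zero (n : ℕ) (l : ℝ) (z : HLayer n) :
    laguerreFun n 0 l z = Real.exp (-(l * ‖z‖ ^ 2 / 4)) := by
  simp [laguerreFun, laguerrePoly]

namespace HTypeAlgebra

variable {n m : ℕ} (H : HTypeAlgebra n m)

/-- The twisted convolution of `u` with the Laguerre function `φ_k^{|a|}`, for the twist that the
central character `t ↦ exp(-i⟨a, t⟩)` induces. -/
def twistedLaguerre (k : ℕ) (u : HLayer n → ℂ) (a : HCentre m) (z : HLayer n) : ℂ :=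
  ∫ w, u w * (Complex.exp (Complex.I * ((⟪a, (1 / 2 : ℝ) • H.bracket w z⟫ : ℝ) : ℂ)) *
    ((laguerreFun n k ‖a‖ (z - w) : ℝ) : ℂ))

theorem conv_jointEigenfun (k : ℕ) (u : HLayer n → ℂ) (v : HCentre m → ℂ) (a : HCentre m)
    (x : HLayer n × HCentre m) :
    H.conv (fun y => u y.1 * v y.2) (jointEigenfun n k a) x =
      Complex.exp (-(Complex.I * ((⟪a, x.2⟫ : ℝ) : ℂ))) *
        (centralTransform v a * H.twistedLaguerre k u a x.1) := by
  rw [conv, mul_comm (centralTransform v a), twistedLaguerre, centralTransform,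
    ← integral_prod_mul, ← integral_const_mul, ← Measure.volume_eq_prod]
  refine integral_congr_ae (Eventually.of_forall fun y => ?_)
  have h : ⟪a, (H.mul (inv y) x).2⟫
      = ⟪a, x.2⟫ - ⟪a, y.2⟫ - ⟪a, (1 / 2 : ℝ) • H.bracket y.1 x.1⟫ := by
    simp only [mul, inv, map_neg, LinearMap.neg_apply, smul_neg, inner_add_right, inner_neg_right]
    ring
  have h1 : (H.mul (inv y) x).1 = x.1 - y.1 := by
    simp only [mul, inv]
    abel
  have h2 : Complex.exp (-(Complex.I * ((⟪a, (H.mul (inv y) x).2⟫ : ℝ) : ℂ)))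
      = Complex.exp (-(Complex.I * ((⟪a, x.2⟫ : ℝ) : ℂ))) *
        Complex.exp (Complex.I * ((⟪a, y.2⟫ : ℝ) : ℂ)) *
        Complex.exp (Complex.I * ((⟪a, (1 / 2 : ℝ) • H.bracket y.1 x.1⟫ : ℝ) : ℂ)) := by
    rw [h, ← Complex.exp_add, ← Complex.exp_add]
    congr 1
    push_cast
    ring
  simp only [jointEigenfun, h1]
  rw [h2]
  ring

theorem continuous_twistedLaguerre_zero (u : 𝓢(HLayer n, ℂ)) :
    Continuous fun y : HCentre m × HLayer n => H.twistedLaguerre 0 u y.1 y.2 := by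
  have hb1 : ∀ w, Continuous (H.bracket w) := fun w =>
    LinearMap.continuous_of_finiteDimensional _
  have hb2 : ∀ z, Continuous fun w => H.bracket w z := fun z =>
    LinearMap.continuous_of_finiteDimensional (H.bracket.flip z)
  simp only [twistedLaguerre, laguerreFun_zero]
  refine continuous_of_dominated (bound := fun w => ‖u w‖) (fun y => ?_) (fun y => ?_)
    u.integrable.norm (Eventually.of_forall fun w => ?_)
  · refine Continuous.aestronglyMeasurable ?_
    have := hb2 y.2
    have := u.continuous
    fun_prop
  · refine Eventually.of_forall fun w => ?_
    rw [norm_mul, norm_mul, mul_comm Complex.I, Complex.norm_exp_ofReal_mul_I, one_mul,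
      Complex.norm_real, Real.norm_of_nonneg (Real.exp_pos _).le]
    refine mul_le_of_le_one_right (norm_nonneg _) (Real.exp_le_one_iff.2 ?_)
    rw [neg_nonpos]
    positivity
  · have := (hb1 w).comp (continuous_snd (X := HCentre m))
    simp only [Function.comp_def] at this
    fun_prop

/-- The integral over the sphere of radius `l` that the ground states contribute to the joint
functional calculus, applied to `u ⊗ v`. -/
def groundSphereIntegral (u : HLayer n → ℂ) (v : HCentre m → ℂ) (x : HLayer n × HCentre m)
    (l : ℝ) : ℂ :=
  ∫ ω : Metric.sphere (0 : HCentre m) 1,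
    Complex.exp (-(Complex.I * ((⟪l • (ω : HCentre m), x.2⟫ : ℝ) : ℂ))) *
      (centralTransform v (l • (ω : HCentre m)) * H.twistedLaguerre 0 u (l • (ω : HCentre m)) x.1)
        ∂((volume : Measure (HCentre m)).toSphere)

theorem continuous_groundSphereIntegral (u : 𝓢(HLayer n, ℂ)) {v : HCentre m → ℂ}
    (hv : Continuous (centralTransform v)) (x : HLayer n × HCentre m) :
    Continuous (H.groundSphereIntegral u v x) := by
  have h := continuous_parametric_integral_of_continuous
    (μ := (volume : Measure (HCentre m)).toSphere) (s := univ)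
    (f := fun (l : ℝ) (ω : Metric.sphere (0 : HCentre m) 1) =>
      Complex.exp (-(Complex.I * ((⟪l • (ω : HCentre m), x.2⟫ : ℝ) : ℂ))) *
        (centralTransform v (l • (ω : HCentre m)) *
          H.twistedLaguerre 0 u (l • (ω : HCentre m)) x.1)) ?_ isCompact_univ
  · simp only [Measure.restrict_univ] at h
    exact h
  · have hs : Continuous fun y : ℝ × Metric.sphere (0 : HCentre m) 1 => y.1 • (y.2 : HCentre m) := by
      fun_prop
    have h1 := hv.comp hs
    have h2 := (H.continuous_twistedLaguerre_zero u).comp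
      (hs.prodMk (continuous_const (y := x.1)))
    simp only [Function.comp_def] at h1 h2
    simp only [Function.uncurry_def]
    fun_prop

/-- If the Fourier transform of `v` vanishes on a ball that contains the frequencies `l` with
`(2k + n) l + l² = μ`, `k ≥ 1`, then only the frequency with `k = 0` contributes to the
restriction operator. -/
theorem isRestriction_tensor {μ l₀ r : ℝ} (hl : 0 < l₀) (hμ : l₀ ^ 2 + n * l₀ = μ)
    (hr0 : 0 < r) (hr : μ < (2 + n) * r + r ^ 2) (u : 𝓢(HLayer n, ℂ)) {v : HCentre m → ℂ}
    (hv : Continuous (centralTransform v)) (hv0 : ∀ a, ‖a‖ < r → centralTransform v a = 0) :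
    H.IsRestriction μ (fun y => u y.1 * v y.2) fun x => ((n : ℝ) + 2 * l₀)⁻¹ •
      ((((1 / (2 * Real.pi) ^ (n + m) : ℝ)) : ℂ) * ((l₀ ^ (n + m - 1) : ℝ) : ℂ) *
        H.groundSphereIntegral u v x l₀) := by
  intro x
  have hB : Continuous fun l : ℝ => (((1 / (2 * Real.pi) ^ (n + m) : ℝ)) : ℂ) *
      ((l ^ (n + m - 1) : ℝ) : ℂ) * H.groundSphereIntegral u v x l := by
    have := H.continuous_groundSphereIntegral u hv x
    fun_prop
  refine (tendsto_window_average (Nat.cast_nonneg n) hl hμ hB).congr' ?_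
  have hε : ∀ᶠ ε : ℝ in 𝓝[>] 0, 0 < ε ∧ ε < (2 + n) * r + r ^ 2 - μ :=
    Ioo_mem_nhdsGT (by linarith)
  filter_upwards [hε] with ε hε
  congr 1
  rw [laplacianWindow, functionalCalculus]
  refine setIntegral_congr_fun measurableSet_Ioi fun l hl0 => ?_
  have hl0 : 0 < l := hl0
  simp only [conv_jointEigenfun]
  rw [tsum_eq_single 0]
  · simp only [groundSphereIntegral, CharP.cast_eq_zero, mul_zero, zero_add]
    push_cast
    ring
  · -- For `k ≥ 1` either the Fourier transform of `v` vanishes at the frequency `l`, or `l` is so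
    -- large that `(2k + n) l + l²` lies to the right of the window.
    intro k hk
    have hk1 : (1 : ℝ) ≤ k := by exact_mod_cast Nat.one_le_iff_ne_zero.2 hk
    rcases lt_or_ge l r with h | h
    · have h0 : ∀ ω : Metric.sphere (0 : HCentre m) 1,
          centralTransform v (l • (ω : HCentre m)) = 0 := fun ω => hv0 _ <| by
        rw [norm_smul, mem_sphere_zero_iff_norm.1 ω.2, mul_one, Real.norm_of_nonneg hl0.le]
        exact h
      simp [h0]
    · rw [indicator_of_notMem]
      · simp
      · refine fun hmem => absurd hmem.2 (not_lt.2 ?_)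
        have h1 : (2 + n) * r ≤ (2 * k + n) * l := by gcongr; linarith
        have h2 : r ^ 2 ≤ l ^ 2 := by gcongr
        linarith

end HTypeAlgebra

/-! ### Bump functions adapted to a Knapp cap -/

section Knapp

variable {m : ℕ} (i₀ : Fin m)

theorem integral_comp_anisoDilation {a b : ℝ} (ha : a ≠ 0) (hb : b ≠ 0) {f : HCentre m → ℂ}
    (hf : Continuous f) :
    ∫ x, f (anisoDilation i₀ a b x) = |(a * b ^ (m - 1))⁻¹| • ∫ x, f x := by
  have h := Measure.map_linearMap_addHaar_eq_smul_addHaar (volume : Measure (HCentre m))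
    (f := anisoDilation i₀ a b) (by rw [det_anisoDilation]; positivity)
  rw [← integral_map (continuous_anisoDilation i₀ a b).aemeasurable hf.aestronglyMeasurable, h,
    integral_smul_measure, det_anisoDilation, ENNReal.toReal_ofReal (abs_nonneg _)]

theorem eLpNorm_comp_anisoDilation {n : ℕ} {a b : ℝ} (ha : a ≠ 0) (hb : b ≠ 0)
    {f : HLayer n × HCentre m → ℂ} (hf : Continuous f) (p : ℝ≥0∞) :
    eLpNorm (fun x : HLayer n × HCentre m => f (x.1, anisoDilation i₀ a b x.2)) p volume =
      ENNReal.ofReal |(a * b ^ (m - 1))⁻¹| ^ (1 / p).toReal * eLpNorm f p volume := by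
  set A : HLayer n × HCentre m →ₗ[ℝ] HLayer n × HCentre m :=
    LinearMap.prodMap LinearMap.id (anisoDilation i₀ a b) with hA
  have hdet : LinearMap.det A = a * b ^ (m - 1) := by
    rw [hA, LinearMap.det_prodMap, LinearMap.det_id, one_mul, det_anisoDilation]
  have hne : LinearMap.det A ≠ 0 := by rw [hdet]; positivity
  have : (volume : Measure (HLayer n × HCentre m)).IsAddHaarMeasure := by
    rw [Measure.volume_eq_prod]
    infer_instance
  have h := Measure.map_linearMap_addHaar_eq_smul_addHaar
    (volume : Measure (HLayer n × HCentre m)) hne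
  have hA' : Continuous A := LinearMap.continuous_of_finiteDimensional _
  change eLpNorm (f ∘ A) p volume = _
  rw [← eLpNorm_map_measure hf.aestronglyMeasurable hA'.aemeasurable, h,
    eLpNorm_smul_measure_of_ne_zero, hdet, smul_eq_mul]
  rw [ne_eq, ENNReal.ofReal_eq_zero, not_le, abs_pos]
  exact inv_ne_zero hne

/-- A fixed smooth bump function on the centre, equal to `1` on the unit ball and supported in the
ball of radius `2`. -/
def centralBump (m : ℕ) : ContDiffBump (0 : HCentre m) := ⟨1, 2, one_pos, one_lt_two⟩

/-- A bump function adapted to a Knapp cap at `b`: thickness of order `s ^ 2` in the direction of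
the `i₀`-th unit vector, and width of order `s` in the orthogonal directions. -/
def knappBump (b : HCentre m) {s : ℝ} (hs : s ≠ 0) : 𝓢(HCentre m, ℂ) :=
  HasCompactSupport.toSchwartzMap
    (f := fun a => ((centralBump m (anisoDilation i₀ (s⁻¹ ^ 2) s⁻¹ (a - b)) : ℝ) : ℂ))
    (by
      set K := (fun y => anisoDilation i₀ (s ^ 2) s y + b) '' Metric.closedBall 0 2
      have hK : IsCompact K := (isCompact_closedBall _ _).image
        ((continuous_anisoDilation i₀ _ _).add continuous_const)
      refine HasCompactSupport.intro hK fun a ha => ?_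
      rw [Complex.ofReal_eq_zero]
      refine ContDiffBump.zero_of_le_dist _ (not_lt.1 fun hlt => ha ?_)
      refine ⟨anisoDilation i₀ (s⁻¹ ^ 2) s⁻¹ (a - b), Metric.mem_closedBall.2 hlt.le, ?_⟩
      simp only [anisoDilation_anisoDilation]
      rw [← mul_pow, mul_inv_cancel₀ hs, one_pow, anisoDilation_one_one, sub_add_cancel])
    (by
      refine Complex.ofRealCLM.contDiff.comp ((centralBump m).contDiff.comp ?_)
      exact (LinearMap.toContinuousLinearMap (anisoDilation i₀ (s⁻¹ ^ 2) s⁻¹)).contDiff.comp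
        (contDiff_id.sub contDiff_const))

theorem knappBump_apply (b : HCentre m) {s : ℝ} (hs : s ≠ 0) (a : HCentre m) :
    knappBump i₀ b hs a = ((centralBump m (anisoDilation i₀ (s⁻¹ ^ 2) s⁻¹ (a - b)) : ℝ) : ℂ) := rfl

/-- The Fourier transform of the bump function at a Knapp cap is, up to a phase and the volume factor
`s ^ (m + 1)`, a dilate of a fixed Schwartz function. -/
theorem norm_fourier_knappBump (b : HCentre m) {s : ℝ} (hs : 0 < s) (t : HCentre m) :
    ‖(𝓕 (knappBump i₀ b hs.ne') : 𝓢(HCentre m, ℂ)) t‖ = s ^ (m + 1) *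
      ‖(𝓕 (knappBump i₀ (0 : HCentre m) one_ne_zero) : 𝓢(HCentre m, ℂ))
        (anisoDilation i₀ (s ^ 2) s t)‖ := by
  have hm : m ≠ 0 := fun h => by subst h; exact i₀.elim0
  have hdet : |((s⁻¹ ^ 2) * s⁻¹ ^ (m - 1))⁻¹| = s ^ (m + 1) := by
    rw [← pow_add, inv_pow, inv_inv, abs_of_pos (by positivity)]
    congr 1
    omega
  set G : HCentre m → ℂ := fun c =>
    Complex.exp ((-2 * Real.pi * ⟪c, anisoDilation i₀ (s ^ 2) s t⟫ : ℝ) * Complex.I) •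
      ((centralBump m c : ℝ) : ℂ) with hG
  have hGc : Continuous G := by
    have := (centralBump m).continuous
    fun_prop
  have h1 : (𝓕 (knappBump i₀ (0 : HCentre m) one_ne_zero) : 𝓢(HCentre m, ℂ))
      (anisoDilation i₀ (s ^ 2) s t) = ∫ c, G c := by
    rw [SchwartzMap.fourier_coe, Real.fourier_eq']
    refine integral_congr_ae (Eventually.of_forall fun c => ?_)
    simp only [knappBump_apply, hG, inv_one, one_pow, sub_zero, anisoDilation_one_one]
  have h2 : (𝓕 (knappBump i₀ b hs.ne') : 𝓢(HCentre m, ℂ)) t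
      = Complex.exp ((-2 * Real.pi * ⟪b, t⟫ : ℝ) * Complex.I) *
        ∫ c, G (anisoDilation i₀ (s⁻¹ ^ 2) s⁻¹ c) := by
    rw [SchwartzMap.fourier_coe, Real.fourier_eq',
      ← integral_sub_right_eq_self (fun c => G (anisoDilation i₀ (s⁻¹ ^ 2) s⁻¹ c)) b,
      ← integral_const_mul]
    refine integral_congr_ae (Eventually.of_forall fun a => ?_)
    simp only [knappBump_apply, hG, smul_eq_mul]
    rw [inner_anisoDilation, anisoDilation_anisoDilation, ← mul_pow, inv_mul_cancel₀ hs.ne',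
      one_pow, anisoDilation_one_one, ← mul_assoc, ← Complex.exp_add, inner_sub_left]
    congr 2
    push_cast
    ring
  rw [h2, h1, norm_mul, Complex.norm_exp_ofReal_mul_I, one_mul,
    integral_comp_anisoDilation i₀ (by positivity) (by positivity) hGc, hdet, norm_smul,
    Real.norm_of_nonneg (by positivity)]

/-- The support of `knappBump` at `b` lies in the image under the dilation by `(s ^ 2, s)` of a fixed
ball, translated to `b`. -/
theorem norm_sub_le_of_knappBump_ne_zero {b a : HCentre m} {s : ℝ} (hs : 0 < s) (hs1 : s ≤ 1)
    (h : knappBump i₀ b hs.ne' a ≠ 0) :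
    ∃ c : HCentre m, ‖c‖ ≤ 2 ∧ anisoDilation i₀ (s ^ 2) s c = a - b ∧ ‖a - b‖ ≤ 2 * s := by
  set c := anisoDilation i₀ (s⁻¹ ^ 2) s⁻¹ (a - b) with hc
  have hc2 : ‖c‖ ≤ 2 := by
    by_contra hlt
    refine h ?_
    rw [knappBump_apply, Complex.ofReal_eq_zero]
    refine ContDiffBump.zero_of_le_dist _ ?_
    rw [dist_zero_right]
    exact (not_le.1 hlt).le
  have hDc : anisoDilation i₀ (s ^ 2) s c = a - b := by
    rw [hc, anisoDilation_anisoDilation, ← mul_pow, mul_inv_cancel₀ hs.ne', one_pow,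
      anisoDilation_one_one]
  refine ⟨c, hc2, hDc, ?_⟩
  rw [← hDc]
  have h1 : ‖anisoDilation i₀ (s ^ 2) s c‖ ≤ s * ‖c‖ := by
    refine norm_anisoDilation_le i₀ ?_ (abs_of_pos hs).le c
    rw [abs_of_nonneg (by positivity)]
    nlinarith
  nlinarith

end Knapp

/-! ### Lower bound for the restriction of a Knapp example -/

/-- A fixed smooth bump function on `𝔳`. -/
def layerBump (n : ℕ) : ContDiffBump (0 : HLayer n) := ⟨1, 2, one_pos, one_lt_two⟩

/-- The bump function `layerBump` as a complex valued Schwartz function. -/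
def layerSchwartz (n : ℕ) : 𝓢(HLayer n, ℂ) :=
  HasCompactSupport.toSchwartzMap (f := fun z => ((layerBump n z : ℝ) : ℂ))
    ((layerBump n).hasCompactSupport.comp_left Complex.ofReal_zero)
    (Complex.ofRealCLM.contDiff.comp (layerBump n).contDiff)

theorem layerSchwartz_apply (n : ℕ) (z : HLayer n) :
    layerSchwartz n z = ((layerBump n z : ℝ) : ℂ) := rfl

namespace HTypeAlgebra

variable {n m : ℕ} (H : HTypeAlgebra n m) (i₀ : Fin m)

theorem re_twistedLaguerre_zero_pos (a : HCentre m) :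
    0 < (H.twistedLaguerre 0 (layerSchwartz n) a 0).re := by
  have h : H.twistedLaguerre 0 (layerSchwartz n) a 0
      = ((∫ w, layerBump n w * Real.exp (-(‖a‖ * ‖w‖ ^ 2 / 4)) : ℝ) : ℂ) := by
    rw [twistedLaguerre, ← integral_complex_ofReal]
    refine integral_congr_ae (Eventually.of_forall fun w => ?_)
    simp [layerSchwartz_apply, laguerreFun_zero]
  rw [h, Complex.ofReal_re]
  have hc := (layerBump n).continuous
  refine Continuous.integral_pos_of_hasCompactSupport_nonneg_nonzero (x := 0) (by fun_prop)
    ((layerBump n).hasCompactSupport.mul_right) (fun w => ?_) ?_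
  · exact mul_nonneg (layerBump n).nonneg (Real.exp_pos _).le
  · rw [(layerBump n).one_of_mem_closedBall (Metric.mem_closedBall_self (by simp [layerBump]))]
    simp

/-- Over the region where all phases `⟨l₀ω - l₀e, t⟩` with `l₀ω` in the Knapp cap are small, there
is no cancellation, and the spherical integral is comparable to the measure of the cap. -/
theorem exists_le_norm_groundSphereIntegral {l₀ : ℝ} (hl : 0 < l₀) :
    ∃ ρ κ s₁ : ℝ, 0 < ρ ∧ 0 < κ ∧ 0 < s₁ ∧ s₁ ≤ 1 ∧ ∀ (s : ℝ) (hs : 0 < s), s ≤ s₁ →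
      ∀ x : HLayer n × HCentre m, ‖x.1‖ < ρ → ‖anisoDilation i₀ (s ^ 2) s x.2‖ < ρ →
        κ * s ^ (m - 1) ≤ ‖H.groundSphereIntegral (layerSchwartz n)
          (𝓕 (knappBump i₀ ((l₀ / (2 * Real.pi)) • EuclideanSpace.single i₀ 1) hs.ne') :
            𝓢(HCentre m, ℂ)) x l₀‖ := by
  set e : HCentre m := EuclideanSpace.single i₀ 1 with he
  set L : ℝ := l₀ / (2 * Real.pi) with hL
  have hpi := Real.pi_pos
  have hLpos : 0 < L := by positivity
  -- `Φ` is the integrand, as a function of the phase, the frequency and `z`; by continuity its real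
  -- part is bounded below near the positive value at `(0, l₀ e, 0)`.
  set Φ : ℝ × HCentre m × HLayer n → ℂ := fun y =>
    Complex.exp (-(Complex.I * (y.1 : ℂ))) *
      H.twistedLaguerre 0 (layerSchwartz n) y.2.1 y.2.2 with hΦ
  have hΦc : Continuous Φ := by
    have h := (H.continuous_twistedLaguerre_zero (layerSchwartz n)).comp
      (continuous_snd (X := ℝ) (Y := HCentre m × HLayer n))
    simp only [Function.comp_def] at h
    fun_prop
  have hpos : 0 < (Φ (0, l₀ • e, 0)).re := by
    simpa [hΦ] using H.re_twistedLaguerre_zero_pos (l₀ • e)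
  set c₀ := (Φ (0, l₀ • e, 0)).re / 2 with hc₀
  have hc₀pos : 0 < c₀ := by positivity
  have hev : ∀ᶠ y in 𝓝 ((0 : ℝ), l₀ • e, (0 : HLayer n)), c₀ < (Φ y).re :=
    (Complex.continuous_re.comp hΦc).continuousAt.eventually (lt_mem_nhds (by
      simp only [Function.comp_apply]
      linarith))
  obtain ⟨δ, hδ, hball⟩ := Metric.eventually_nhds_iff.1 hev
  obtain ⟨κ, hκ0, hκt, hcap⟩ := exists_mul_pow_le_toSphere_cap i₀ hLpos
  refine ⟨δ / (4 * Real.pi), c₀ * κ.toReal, min 1 (δ / (8 * Real.pi)), by positivity,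
    mul_pos hc₀pos (ENNReal.toReal_pos hκ0 hκt), by positivity, min_le_left _ _,
    fun s hs hs1 x hx1 hx2 => ?_⟩
  have hsle : s ≤ 1 := hs1.trans (min_le_left _ _)
  have hsδ : 4 * Real.pi * s < δ := by
    have h := hs1.trans (min_le_right _ _)
    rw [le_div_iff₀ (by positivity)] at h
    nlinarith
  set φ := knappBump i₀ (L • e) hs.ne' with hφ
  set σ := (volume : Measure (HCentre m)).toSphere with hσ
  -- the values of the bump function on the sphere
  set b : Metric.sphere (0 : HCentre m) 1 → ℝ := fun ω =>
    centralBump m (anisoDilation i₀ (s⁻¹ ^ 2) s⁻¹ (L • (ω : HCentre m) - L • e)) with hb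
  have hbφ : ∀ ω : Metric.sphere (0 : HCentre m) 1,
      centralTransform (𝓕 φ : 𝓢(HCentre m, ℂ)) (l₀ • (ω : HCentre m)) = (b ω : ℂ) := fun ω => by
    rw [centralTransform_fourier, smul_smul, hφ, knappBump_apply, inv_mul_eq_div, ← hL]
  have hbc : Continuous b := (centralBump m).continuous.comp
    ((continuous_anisoDilation i₀ _ _).comp (by fun_prop))
  have hΦω : Continuous fun ω : Metric.sphere (0 : HCentre m) 1 =>
      Φ (⟪l₀ • (ω : HCentre m) - l₀ • e, x.2⟫, l₀ • (ω : HCentre m), x.1) :=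
    hΦc.comp (by fun_prop)
  -- Multiplication by the phase of the centre of the cap leaves only the phases of the differences
  -- `l₀ω - l₀e`.
  have hphase : Complex.exp (((l₀ * ⟪e, x.2⟫ : ℝ) : ℂ) * Complex.I) *
      H.groundSphereIntegral (layerSchwartz n) (𝓕 φ : 𝓢(HCentre m, ℂ)) x l₀
      = ∫ ω : Metric.sphere (0 : HCentre m) 1,
        (b ω : ℂ) * Φ (⟪l₀ • (ω : HCentre m) - l₀ • e, x.2⟫, l₀ • (ω : HCentre m), x.1) ∂σ := by
    rw [groundSphereIntegral, ← integral_const_mul]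
    refine integral_congr_ae (Eventually.of_forall fun ω => ?_)
    simp only [hbφ, hΦ]
    rw [← mul_assoc, ← Complex.exp_add, mul_left_comm, ← mul_assoc, ← mul_assoc]
    congr 3
    rw [inner_sub_left, real_inner_smul_left e]
    push_cast
    ring
  have hint : Integrable (fun ω : Metric.sphere (0 : HCentre m) 1 =>
      (b ω : ℂ) * Φ (⟪l₀ • (ω : HCentre m) - l₀ • e, x.2⟫, l₀ • (ω : HCentre m), x.1)) σ :=
    ((Complex.continuous_ofReal.comp hbc).mul hΦω).integrable_of_hasCompactSupport
      (HasCompactSupport.of_compactSpace _)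
  have hpt : ∀ ω : Metric.sphere (0 : HCentre m) 1, c₀ * b ω ≤
      ((b ω : ℂ) * Φ (⟪l₀ • (ω : HCentre m) - l₀ • e, x.2⟫, l₀ • (ω : HCentre m), x.1)).re :=
    fun ω => by
    rw [Complex.re_ofReal_mul, mul_comm]
    by_cases hbω : b ω = 0
    · simp [hbω]
    refine mul_le_mul_of_nonneg_left ?_ (centralBump m).nonneg
    have hne : knappBump i₀ (L • e) hs.ne' (L • (ω : HCentre m)) ≠ 0 := by
      rw [knappBump_apply]
      exact_mod_cast hbω
    obtain ⟨c, hc2, hDc, hle⟩ := norm_sub_le_of_knappBump_ne_zero i₀ hs hsle hne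
    have hscale : l₀ • (ω : HCentre m) - l₀ • e
        = (2 * Real.pi) • (L • (ω : HCentre m) - L • e) := by
      rw [smul_sub, smul_smul, smul_smul, hL, mul_div_cancel₀ _ (by positivity)]
    refine (hball ?_).le
    rw [Prod.dist_eq, Prod.dist_eq, max_lt_iff, max_lt_iff]
    refine ⟨?_, ?_, ?_⟩
    · -- The phase is `2π⟨c, D t⟩` for the dilation `D`, so it is small on the dual box.
      rw [dist_zero_right, hscale, ← hDc, real_inner_smul_left, inner_anisoDilation, norm_mul,
        Real.norm_of_nonneg (by positivity : (0 : ℝ) ≤ 2 * Real.pi)]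
      have h1 := norm_inner_le_norm (𝕜 := ℝ) c (anisoDilation i₀ (s ^ 2) s x.2)
      have h2 : ‖c‖ * ‖anisoDilation i₀ (s ^ 2) s x.2‖
          ≤ 2 * ‖anisoDilation i₀ (s ^ 2) s x.2‖ := by gcongr
      rw [lt_div_iff₀ (by positivity)] at hx2
      nlinarith
    · change dist (l₀ • (ω : HCentre m)) (l₀ • e) < δ
      rw [dist_eq_norm, hscale, norm_smul,
        Real.norm_of_nonneg (by positivity : (0 : ℝ) ≤ 2 * Real.pi)]
      nlinarith
    · change dist x.1 0 < δ
      rw [dist_zero_right]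
      refine hx1.trans_le (div_le_self hδ.le ?_)
      linarith [Real.pi_gt_three]
  set S := {ω : Metric.sphere (0 : HCentre m) 1 | ‖anisoDilation i₀ (s⁻¹ ^ 2) s⁻¹
    (L • ((ω : HCentre m) - e))‖ ≤ 1} with hS
  have hSm : MeasurableSet S :=
    (isClosed_le (((continuous_anisoDilation i₀ _ _).comp (by fun_prop)).norm)
      continuous_const).measurableSet
  have hSb : ∀ ω, S.indicator (fun _ => c₀) ω ≤ c₀ * b ω := fun ω => by
    by_cases hω : ω ∈ S
    · rw [indicator_of_mem hω, hb]
      simp only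
      rw [ContDiffBump.one_of_mem_closedBall, mul_one]
      rw [mem_closedBall_zero_iff, ← smul_sub]
      exact hω
    · rw [indicator_of_notMem hω]
      exact mul_nonneg hc₀pos.le (centralBump m).nonneg
  have hSσ : κ.toReal * s ^ (m - 1) ≤ σ.real S := by
    have h := ENNReal.toReal_mono (measure_ne_top _ _) (hcap s hs hsle)
    rwa [ENNReal.toReal_mul, ENNReal.toReal_ofReal (by positivity)] at h
  calc c₀ * κ.toReal * s ^ (m - 1) ≤ c₀ * σ.real S := by
        rw [mul_assoc]
        gcongr
    _ = ∫ ω, S.indicator (fun _ => c₀) ω ∂σ := by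
        rw [integral_indicator_const _ hSm, smul_eq_mul, mul_comm]
    _ ≤ ∫ ω, ((b ω : ℂ) *
          Φ (⟪l₀ • (ω : HCentre m) - l₀ • e, x.2⟫, l₀ • (ω : HCentre m), x.1)).re ∂σ := by
        refine integral_mono ((integrable_const _).indicator hSm) hint.re fun ω => ?_
        exact (hSb ω).trans (hpt ω)
    _ = (∫ ω, (b ω : ℂ) *
          Φ (⟪l₀ • (ω : HCentre m) - l₀ • e, x.2⟫, l₀ • (ω : HCentre m), x.1) ∂σ).re :=
        integral_re hint
    _ ≤ _ := by
        rw [← hphase]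
        refine (Complex.re_le_norm _).trans ?_
        rw [norm_mul, Complex.norm_exp_ofReal_mul_I, one_mul]

end HTypeAlgebra

/-! ### Norms of the Knapp examples and the conclusion -/

/-- The change of variables in the centre: the norm is the one at `s = 1`, times the height
`s ^ (m + 1)` and the power `1 / p` of the volume `s ^ (-(m + 1))` of the dual box. -/
theorem eLpNorm_schwartzTensor_fourier_knappBump {n m : ℕ} (i₀ : Fin m) (u : 𝓢(HLayer n, ℂ))
    (b : HCentre m) {s : ℝ} (hs : 0 < s) (p : ℝ≥0∞) :
    eLpNorm (schwartzTensor u (𝓕 (knappBump i₀ b hs.ne') : 𝓢(HCentre m, ℂ))) p volume =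
      ENNReal.ofReal (s ^ (m + 1)) * (ENNReal.ofReal (s ^ (m + 1))⁻¹ ^ (1 / p).toReal *
        eLpNorm (schwartzTensor u (𝓕 (knappBump i₀ (0 : HCentre m) one_ne_zero) : 𝓢(HCentre m, ℂ)))
          p volume) := by
  have hm : m ≠ 0 := fun h => by subst h; exact i₀.elim0
  have hdet : |(s ^ 2 * s ^ (m - 1))⁻¹| = (s ^ (m + 1))⁻¹ := by
    rw [← pow_add, abs_of_pos (by positivity)]
    congr 2
    omega
  set F := schwartzTensor u (𝓕 (knappBump i₀ (0 : HCentre m) one_ne_zero) : 𝓢(HCentre m, ℂ))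
  have h := eLpNorm_comp_anisoDilation i₀ (pow_ne_zero 2 hs.ne') hs.ne' F.continuous p
  rw [hdet] at h
  rw [← h, ← Real.enorm_of_nonneg (by positivity : 0 ≤ s ^ (m + 1)), ← eLpNorm_const_smul]
  refine eLpNorm_congr_norm_ae (Eventually.of_forall fun x => ?_)
  simp only [F, schwartzTensor_apply, Pi.smul_apply, norm_mul, norm_smul,
    norm_fourier_knappBump i₀ b hs]
  rw [Real.norm_of_nonneg (by positivity)]
  ring

theorem volume_dual_knapp_box {m : ℕ} (i₀ : Fin m) {s : ℝ} (hs : 0 < s) (A : Set (HCentre m)) :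
    volume (anisoDilation i₀ (s ^ 2) s ⁻¹' A) = ENNReal.ofReal (s ^ (m + 1))⁻¹ * volume A := by
  have hm : m ≠ 0 := fun h => by subst h; exact i₀.elim0
  have hdet : LinearMap.det (anisoDilation i₀ (s ^ 2) s) = s ^ (m + 1) := by
    rw [det_anisoDilation, ← pow_add]
    congr 1
    omega
  rw [Measure.addHaar_preimage_linearMap _ (by rw [hdet]; positivity), hdet,
    abs_of_pos (by positivity)]

/-- The condition on `p`, expressed by the dual exponent: `1 / q > (m - 1) / (2 (m + 1))`. -/
theorem lt_toReal_one_div_of_holderConjugate {m : ℕ} {p q : ℝ≥0∞} (hpq : p.HolderConjugate q)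
    (hp : (2 * (m : ℝ≥0∞) + 2) / ((m : ℝ≥0∞) + 3) < p) :
    (1 / p).toReal + (1 / q).toReal = 1 ∧ ((m : ℝ) - 1) < 2 * (m + 1) * (1 / q).toReal := by
  have h1 : p⁻¹ + q⁻¹ = 1 := ENNReal.HolderConjugate.inv_add_inv_eq_one p q
  have hpt : p⁻¹ ≠ ∞ := ne_top_of_le_ne_top ENNReal.one_ne_top (h1 ▸ le_self_add)
  have hqt : q⁻¹ ≠ ∞ := ne_top_of_le_ne_top ENNReal.one_ne_top (h1 ▸ le_add_self)
  have h2 : (p⁻¹).toReal + (q⁻¹).toReal = 1 := by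
    rw [← ENNReal.toReal_add hpt hqt, h1, ENNReal.toReal_one]
  have h3 := ENNReal.inv_lt_inv.2 hp
  have hne : ((2 * (m : ℝ≥0∞) + 2) / ((m : ℝ≥0∞) + 3))⁻¹ ≠ ∞ := by
    rw [ENNReal.inv_ne_top]
    exact ENNReal.div_ne_zero.2 ⟨by simp, by simp⟩
  have h4 := (ENNReal.toReal_lt_toReal hpt hne).2 h3
  have h5 : (((2 * (m : ℝ≥0∞) + 2) / ((m : ℝ≥0∞) + 3))⁻¹).toReal
      = ((m : ℝ) + 3) / (2 * m + 2) := by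
    have hmt : 2 * (m : ℝ≥0∞) ≠ ∞ := ENNReal.mul_ne_top (by simp) (by simp)
    have hmt' : (m : ℝ≥0∞) ≠ ∞ := by simp
    rw [ENNReal.toReal_inv, ENNReal.toReal_div, ENNReal.toReal_add hmt (by simp),
      ENNReal.toReal_add hmt' (by simp), ENNReal.toReal_mul]
    simp
  rw [h5, lt_div_iff₀ (by positivity)] at h4
  rw [one_div, one_div]
  refine ⟨h2, ?_⟩
  nlinarith

end

theorem mainTheorem9 (n m : ℕ) (hm : 1 < m) (H : HTypeAlgebra n m) (μ : ℝ) (hμ : 0 < μ)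
    (p q : ℝ≥0∞) (hpq : p.HolderConjugate q)
    (hp : (2 * (m : ℝ≥0∞) + 2) / ((m : ℝ≥0∞) + 3) < p) :
    ¬ ∃ C : ℝ≥0, ∀ (f : 𝓢(HLayer n × HCentre m, ℂ)) (g : HLayer n × HCentre m → ℂ),
      H.IsRestriction μ f g → eLpNorm g q volume ≤ (C : ℝ≥0∞) * eLpNorm f p volume := by
  rintro ⟨C, hC⟩
  obtain ⟨hαβ, hβ⟩ := lt_toReal_one_div_of_holderConjugate hpq hp
  set α := (1 / p).toReal with hα
  set β := (1 / q).toReal with hβdef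
  have hm1 : (1 : ℝ) < m := by exact_mod_cast hm
  have hβ0 : 0 < β := pos_of_mul_pos_right (by linarith) (by positivity : 0 ≤ 2 * ((m : ℝ) + 1))
  have hq0 : q ≠ 0 := fun h => by simp [hβdef, h] at hβ0
  have hqt : q ≠ ∞ := fun h => by simp [hβdef, h] at hβ0
  have hpi := Real.pi_pos
  set i₀ : Fin m := ⟨0, by omega⟩
  -- the frequency `l₀` of the ground state in the spectral sphere of `Δ`
  obtain ⟨l₀, hl, hl₀⟩ : ∃ l₀ : ℝ, 0 < l₀ ∧ l₀ ^ 2 + n * l₀ = μ := by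
    have h1 : (n : ℝ) < √((n : ℝ) ^ 2 + 4 * μ) := Real.lt_sqrt_of_sq_lt (by linarith)
    have h2 := Real.sq_sqrt (by positivity : 0 ≤ (n : ℝ) ^ 2 + 4 * μ)
    refine ⟨(√((n : ℝ) ^ 2 + 4 * μ) - n) / 2, by linarith, ?_⟩
    nlinarith
  -- all other frequencies in the spectral sphere are below `l₀ - η`
  set η : ℝ := l₀ / (2 + n + 2 * l₀) with hη
  have hη0 : 0 < η := by positivity
  have hηmul : η * (2 + n + 2 * l₀) = l₀ := div_mul_cancel₀ _ (by positivity)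
  have hr0 : 0 < l₀ - η := by
    have : η * 1 < η * (2 + n + 2 * l₀) := by
      gcongr
      have : (0 : ℝ) ≤ n := n.cast_nonneg
      linarith
    linarith
  have hr : μ < (2 + n) * (l₀ - η) + (l₀ - η) ^ 2 := by
    have : 0 < η ^ 2 := by positivity
    nlinarith
  obtain ⟨ρ, κ, s₁, hρ, hκ, hs₁, hs₁1, hlow⟩ := H.exists_le_norm_groundSphereIntegral i₀ hl
  set b : HCentre m := (l₀ / (2 * Real.pi)) • EuclideanSpace.single i₀ 1 with hb
  set c : ℝ := ((n : ℝ) + 2 * l₀)⁻¹ * (1 / (2 * Real.pi) ^ (n + m) * l₀ ^ (n + m - 1)) with hc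
  have hc0 : 0 < c := by positivity
  set W : ℝ≥0∞ := volume (Metric.ball (0 : HLayer n) ρ) * volume (Metric.ball (0 : HCentre m) ρ)
    with hW
  have hW0 : W ≠ 0 := mul_ne_zero (Metric.measure_ball_pos _ _ hρ).ne'
    (Metric.measure_ball_pos _ _ hρ).ne'
  have hWt : W ≠ ∞ := ENNReal.mul_ne_top measure_ball_lt_top.ne measure_ball_lt_top.ne
  set F : 𝓢(HLayer n × HCentre m, ℂ) := schwartzTensor (layerSchwartz n)
    (𝓕 (knappBump i₀ (0 : HCentre m) one_ne_zero) : 𝓢(HCentre m, ℂ)) with hF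
  have hMt : eLpNorm F p volume ≠ ∞ := by
    have : (volume : Measure (HLayer n × HCentre m)).IsAddHaarMeasure := by
      rw [Measure.volume_eq_prod]
      infer_instance
    exact (F.eLpNorm_lt_top p volume).ne
  set M : ℝ := (eLpNorm F p volume).toReal with hM
  -- the assumed inequality for the Knapp example, with `‖g‖_q` bounded below over the dual box
  have key : ∀ s : ℝ, 0 < s → s ≤ min s₁ (η / (8 * Real.pi)) →
      ENNReal.ofReal (c * (κ * s ^ (m - 1))) * (ENNReal.ofReal (s ^ (m + 1))⁻¹ * W) ^ β ≤
        C * (ENNReal.ofReal (s ^ (m + 1)) * (ENNReal.ofReal (s ^ (m + 1))⁻¹ ^ α *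
          eLpNorm F p volume)) := fun s hs hsle => by
    have hss : s ≤ s₁ := hsle.trans (min_le_left _ _)
    have hsη : 4 * Real.pi * s < η := by
      have h := hsle.trans (min_le_right _ _)
      rw [le_div_iff₀ (by positivity)] at h
      nlinarith
    set φ := knappBump i₀ b hs.ne' with hφ
    have hcont : Continuous (centralTransform (𝓕 φ : 𝓢(HCentre m, ℂ))) := by
      have h : centralTransform (𝓕 φ : 𝓢(HCentre m, ℂ)) = fun a => φ ((2 * Real.pi)⁻¹ • a) :=
        funext (centralTransform_fourier φ)
      rw [h]
      exact φ.continuous.comp (continuous_const_smul _)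
    have hvan : ∀ a, ‖a‖ < l₀ - η → centralTransform (𝓕 φ : 𝓢(HCentre m, ℂ)) a = 0 :=
      fun a ha => by
      rw [centralTransform_fourier]
      by_contra hne
      obtain ⟨-, -, -, hle⟩ := norm_sub_le_of_knappBump_ne_zero i₀ hs (hss.trans hs₁1) hne
      have h1 : ‖b‖ - ‖(2 * Real.pi)⁻¹ • a‖ ≤ 2 * s := by
        rw [norm_sub_rev] at hle
        exact (norm_sub_norm_le _ _).trans hle
      rw [hb, norm_smul, norm_smul, PiLp.norm_single, norm_one, mul_one,
        Real.norm_of_nonneg (by positivity), Real.norm_of_nonneg (by positivity),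
        inv_mul_eq_div, ← sub_div, div_le_iff₀ (by positivity)] at h1
      nlinarith
    have hrest := H.isRestriction_tensor hl hl₀ hr0 hr (layerSchwartz n) hcont hvan
    have hle := hC (schwartzTensor (layerSchwartz n) (𝓕 φ : 𝓢(HCentre m, ℂ))) _ hrest
    rw [hφ, eLpNorm_schwartzTensor_fourier_knappBump i₀ _ _ hs] at hle
    refine le_trans ?_ hle
    set S : Set (HLayer n × HCentre m) :=
      Metric.ball 0 ρ ×ˢ (anisoDilation i₀ (s ^ 2) s ⁻¹' Metric.ball 0 ρ) with hS
    have hSm : MeasurableSet S := Metric.isOpen_ball.measurableSet.prod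
      ((continuous_anisoDilation i₀ _ _).measurable Metric.isOpen_ball.measurableSet)
    have hSv : volume S = ENNReal.ofReal (s ^ (m + 1))⁻¹ * W := by
      rw [hS, Measure.volume_eq_prod, Measure.prod_prod, volume_dual_knapp_box i₀ hs, hW]
      ring
    have hind := eLpNorm_indicator_const (μ := (volume : Measure (HLayer n × HCentre m)))
      (c := c * (κ * s ^ (m - 1))) hSm hq0 hqt
    have hexp : 1 / q.toReal = β := by
      rw [hβdef, ENNReal.toReal_div, ENNReal.toReal_one]
    rw [hSv, Real.enorm_of_nonneg (by positivity), hexp] at hind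
    rw [← hind]
    refine eLpNorm_mono fun x => ?_
    by_cases hx : x ∈ S
    · rw [indicator_of_mem hx, Real.norm_of_nonneg (by positivity), norm_smul, norm_mul, norm_mul,
        Complex.norm_real, Complex.norm_real, Real.norm_of_nonneg (by positivity),
        Real.norm_of_nonneg (by positivity), Real.norm_of_nonneg (by positivity), ← mul_assoc _ _ ‖_‖,
        ← hc]
      gcongr
      exact hlow s hs hss x (mem_ball_zero_iff.1 hx.1) (mem_ball_zero_iff.1 hx.2)
    · rw [indicator_of_notMem hx, norm_zero]
      exact norm_nonneg _
  set w : ℝ := (W ^ β).toReal with hw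
  have hw0 : 0 < w := ENNReal.toReal_pos (ENNReal.rpow_pos (pos_iff_ne_zero.2 hW0) hWt).ne'
    (ENNReal.rpow_ne_top_of_nonneg hβ0.le hWt)
  -- `γ` is the difference between the exponents of `s` in `‖f‖_p` and in the lower bound of `‖g‖_q`.
  set γ : ℝ := 2 * (m + 1) * β - (m - 1) with hγ
  have hγ0 : 0 < γ := by linarith
  have key' : ∀ s : ℝ, 0 < s → s ≤ min s₁ (η / (8 * Real.pi)) →
      c * κ * w ≤ C * M * s ^ γ := fun s hs hsle => by
    have h := ENNReal.toReal_mono (ENNReal.mul_ne_top ENNReal.coe_ne_top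
      (ENNReal.mul_ne_top ENNReal.ofReal_ne_top (ENNReal.mul_ne_top
        (ENNReal.rpow_ne_top_of_nonneg ENNReal.toReal_nonneg ENNReal.ofReal_ne_top) hMt)))
      (key s hs hsle)
    rw [ENNReal.mul_rpow_of_nonneg _ _ hβ0.le] at h
    simp only [ENNReal.toReal_mul, ← ENNReal.toReal_rpow] at h
    rw [ENNReal.toReal_ofReal (by positivity), ENNReal.toReal_ofReal (by positivity),
      ENNReal.toReal_ofReal (by positivity), ENNReal.toReal_rpow, ← hw, ← hM, ENNReal.coe_toReal]
      at h
    have e1 : ((s ^ (m + 1))⁻¹ : ℝ) = s ^ (-((m : ℝ) + 1)) := by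
      rw [Real.rpow_neg hs.le, ← Nat.cast_add_one, Real.rpow_natCast]
    have e2 : (s ^ (m + 1) : ℝ) = s ^ ((m : ℝ) + 1) := by
      rw [← Nat.cast_add_one, Real.rpow_natCast]
    have e3 : (s ^ (m - 1) : ℝ) = s ^ ((m : ℝ) - 1) := by
      rw [← Nat.cast_pred (by omega), Real.rpow_natCast]
    rw [e1, ← Real.rpow_mul hs.le, ← Real.rpow_mul hs.le, e2, e3] at h
    set a₁ := s ^ ((m : ℝ) - 1) * s ^ (-((m : ℝ) + 1) * β) with ha₁
    have ha₁0 : 0 < a₁ := by positivity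
    have ha₂ : s ^ ((m : ℝ) + 1) * s ^ (-((m : ℝ) + 1) * α) = s ^ γ * a₁ := by
      rw [ha₁, ← Real.rpow_add hs, ← Real.rpow_add hs, ← Real.rpow_add hs]
      congr 1
      rw [hγ, show α = 1 - β by linarith]
      ring
    refine le_of_mul_le_mul_right ?_ ha₁0
    calc c * κ * w * a₁ = c * (κ * s ^ ((m : ℝ) - 1)) * (s ^ (-((m : ℝ) + 1) * β) * w) := by
          rw [ha₁]
          ring
      _ ≤ _ := h
      _ = C * M * (s ^ ((m : ℝ) + 1) * s ^ (-((m : ℝ) + 1) * α)) := by ring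
      _ = C * M * s ^ γ * a₁ := by
          rw [ha₂]
          ring
  have hlim : Tendsto (fun s : ℝ => C * M * s ^ γ) (𝓝[>] 0) (𝓝 0) := by
    have h := ((Real.continuousAt_rpow_const 0 γ (Or.inr hγ0.le)).tendsto.mono_left
      (nhdsWithin_le_nhds (s := Ioi 0))).const_mul (C * M)
    rwa [Real.zero_rpow hγ0.ne', mul_zero] at h
  have hev : ∀ᶠ s : ℝ in 𝓝[>] 0, 0 < s ∧ s ≤ min s₁ (η / (8 * Real.pi)) :=
    Ioc_mem_nhdsGT (by positivity)
  have hfin := ge_of_tendsto hlim (hev.mono fun s hs => key' s hs.1 hs.2)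
  exact absurd hfin (not_le.2 (by positivity))
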